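/- Let $\mathcal X$ be a measurable space, let $\mathrm{sign}(\alpha)=1$ if $\alpha\ge 0$ and $-1$ otherwise, and for a probability distribution $P$ of $(Y,X)$ on $\{-1,1\}\times\mathcal X$, with marginal $P_X$ on $\mathcal X$, and measurable $f:\mathcal X\to[-1,1]$ put $$R(f)=P(\mathrm{sign}(f(X))\neq Y),\qquad R_h(f)=E_P[\max\{0,1-Yf(X)\}].$$ Write $G_f=\{x: f(x)\ge 0\}$ and $\tilde f_G=2\cdot 1\{\cdot\in G\}-1$. Let $\mathcal G$ be a non-empty class of measurable subsets of $\mathcal X$, let $\mathcal F_{\mathcal G}=\{f:\mathcal X\to[-1,1] : G_f\in\mathcal G\}$ and let $\widetilde{\mathcal F}_{\mathcal G}\subseteq\mathcal F_{\mathcal G}$ satisfy (A1) either $\{x: f(x)\ge t\}\in\mathcal G$ for all $f\in\widetilde{\mathcal F}_{\mathcal G}$ and $t\in[-1,1]$, or $\{x: f(x)\le t\}\in\mathcal G$ for all $f\in\widetilde{\mathcal F}_{\mathcal G}$ and $t\in[-1,1]$; (A2) $\tilde f_G\in\widetilde{\mathcal F}_{\mathcal G}$ for every $G\in\mathcal G$.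 Let $\check{\mathcal F}$ be a class of measurable functions $\mathcal X\to[-1,1]$. Let $N^B_1(\epsilon,\check{\mathcal F},P_X)$ be the smallest $k$ such that there are $k$ pairs of measurable functions $f^L_j\le f^U_j$ with $\|f_j^U-f_j^L\|_{L_1(P_X)}<\epsilon$ such that every $f\in\check{\mathcal F}$ satisfies $f^L_j\le f\le f^U_j$ for some $j$, and let $H^B_1=\log N^B_1$ be the bracketing entropy. Let $\mathcal P$ be a class of distributions on $\{-1,1\}\times\mathcal X$ and $C',r'>0$ constants such that $$H^B_1(\epsilon,\check{\mathcal F},P_X)\le C'\epsilon^{-r'}\quad\text{for all }P\in\mathcal P,\ \epsilon>0.$$ Let $n\ge 1$, let $(Y_1,X_1),\dots,(Y_n,X_n)$ be i.i.d. from $P$, with joint law $P^n$, and let $\hat f$, a function of the sample, minimize the empirical hinge risk $\hat R_h(f)=\frac1n\sum_{i=1}^n\max\{0,1-Y_if(X_i)\}$ over $f\in\check{\mathcal F}$, with $R(\hat f)$ and $R_h(\hat f)$ measurable functions of the sample. Put $\tau_n=n^{-1/2}$ if $r'<1$, $\tau_n=\log(n)/\sqrt n$ if $r'=1$, $\tau_n=n^{-1/(r'+1)}$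 if $r'>1$, and $q_n=\sqrt n\,\tau_n$. Then there are positive constants $D_1,D_2,D_3,D_4$, depending only on $C'$ and $r'$, such that with $$L_{C'}(r',n)=\begin{cases}2D_1\tau_n+4D_2\exp(-D_1^2q_n^2)&\text{if } r'\ge 1,\\ 2D_3\tau_n+2n^{-1}D_4&\text{if } r'<1,\end{cases}$$ for every $P\in\mathcal P$, $$E_{P^n}\Big[R(\hat f)-\inf_{f\in\mathcal F_{\mathcal G}}R(f)\Big]\le L_{C'}(r',n)+\tfrac12\Big(\inf_{f\in\check{\mathcal F}}R_h(f)-\inf_{f\in\widetilde{\mathcal F}_{\mathcal G}}R_h(f)\Big)+\tfrac12E_{P^n}\Big[R_h(\tilde f_{G_{\hat f}})-R_h(\hat f)\Big].$$ -/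

import Mathlib

open MeasureTheory
open scoped ENNReal

universe u

noncomputable section

/-- The label set `{-1, 1}`. -/
abbrev Label : Type := ↥({-1, 1} : Set ℝ)

/-- `sign α = 1{α ≥ 0} - 1{α < 0}`; in particular `sign 0 = 1`. -/
def sgn (α : ℝ) : ℝ := if 0 ≤ α then 1 else -1

/-- The prediction set `G_f = {x : f x ≥ 0}` of a classifier. -/
def predictionSet {𝒳 : Type u} (f : 𝒳 → ℝ) : Set 𝒳 := {x | 0 ≤ f x}

/-- The step classifier `2 · 1{x ∈ G} - 1` of a set `G`. -/
def stepClassifier {𝒳 : Type u} (G : Set 𝒳) (x : 𝒳) : ℝ :=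
  2 * G.indicator (fun _ => (1 : ℝ)) x - 1

/-- The class of all classifiers with values in `[-1, 1]` whose prediction set lies in `𝒢`. -/
def constrainedClass {𝒳 : Type u} (𝒢 : Set (Set 𝒳)) : Set (𝒳 → ℝ) :=
  {f | predictionSet f ∈ 𝒢 ∧ ∀ x, f x ∈ Set.Icc (-1 : ℝ) 1}

/-- All upper level sets `{f ≥ t}`, `t ∈ [-1, 1]`, of all members of `F` belong to `𝒢`. -/
def UpperLevelSetsIn {𝒳 : Type u} (F : Set (𝒳 → ℝ)) (𝒢 : Set (Set 𝒳)) : Prop :=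
  ∀ f ∈ F, ∀ t ∈ Set.Icc (-1 : ℝ) 1, {x | t ≤ f x} ∈ 𝒢

/-- All lower level sets `{f ≤ t}`, `t ∈ [-1, 1]`, of all members of `F` belong to `𝒢`. -/
def LowerLevelSetsIn {𝒳 : Type u} (F : Set (𝒳 → ℝ)) (𝒢 : Set (Set 𝒳)) : Prop :=
  ∀ f ∈ F, ∀ t ∈ Set.Icc (-1 : ℝ) 1, {x | f x ≤ t} ∈ 𝒢

/-- The classification risk `R(f) = P(sign(f(X)) ≠ Y)`. -/
def classificationRisk {𝒳 : Type u} [MeasurableSpace 𝒳] (P : Measure (Label × 𝒳))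
    (f : 𝒳 → ℝ) : ℝ :=
  P.real {z | sgn (f z.2) ≠ (z.1 : ℝ)}

/-- The hinge loss `max {0, 1 - α}`. -/
def hingeLoss (α : ℝ) : ℝ := max 0 (1 - α)

/-- The hinge risk `E_P[max {0, 1 - Y f(X)}]`. -/
def hingeRisk {𝒳 : Type u} [MeasurableSpace 𝒳] (P : Measure (Label × 𝒳)) (f : 𝒳 → ℝ) : ℝ :=
  ∫ z, hingeLoss ((z.1 : ℝ) * f z.2) ∂P

/-- The empirical hinge risk of `f` on the sample `s` of size `n`. -/
def empiricalHingeRisk {𝒳 : Type u} {n : ℕ} (s : Fin n → Label × 𝒳) (f : 𝒳 → ℝ) : ℝ :=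
  (1 / (n : ℝ)) * ∑ i, hingeLoss (((s i).1 : ℝ) * f (s i).2)

/-- `F` is covered by `k` brackets `[l j, u j]` whose `L_p(Q)`-size is smaller than `ε`. The
bracket functions are measurable and need not belong to `F`. -/
def IsBracketCover {𝒳 : Type u} [MeasurableSpace 𝒳] (p : ℝ≥0∞) (ε : ℝ) (F : Set (𝒳 → ℝ))
    (Q : Measure 𝒳) (k : ℕ) : Prop :=
  ∃ l u : Fin k → 𝒳 → ℝ,
    (∀ j, Measurable (l j) ∧ Measurable (u j) ∧ (∀ x, l j x ≤ u j x) ∧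
      eLpNorm (fun x => u j x - l j x) p Q < ENNReal.ofReal ε) ∧
    ∀ f ∈ F, ∃ j, ∀ x, l j x ≤ f x ∧ f x ≤ u j x

/-- The `L_p(Q)`-bracketing number: the smallest size of a cover of `F` by `ε`-brackets (`⊤` if
there is no finite cover). -/
def bracketingNumber {𝒳 : Type u} [MeasurableSpace 𝒳] (p : ℝ≥0∞) (ε : ℝ) (F : Set (𝒳 → ℝ))
    (Q : Measure 𝒳) : ℕ∞ :=
  ⨅ (k : ℕ) (_ : IsBracketCover p ε F Q k), (k : ℕ∞)

/-- The `L_p(Q)`-bracketing entropy: the logarithm of the bracketing number (`⊤` if there is no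
finite cover). -/
def bracketingEntropy {𝒳 : Type u} [MeasurableSpace 𝒳] (p : ℝ≥0∞) (ε : ℝ) (F : Set (𝒳 → ℝ))
    (Q : Measure 𝒳) : EReal :=
  ENNReal.log ((bracketingNumber p ε F Q : ℕ∞) : ℝ≥0∞)

/-- The rate `τ_n`: `n^{-1/2}` if `r < 1`, `log n / √n` if `r = 1`, `n^{-1/(r+1)}` if `r > 1`. -/
def rateTau (r : ℝ) (n : ℕ) : ℝ :=
  if r < 1 then (n : ℝ) ^ (-(1 / 2) : ℝ)
  else if r = 1 then Real.log n / √(n : ℝ)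
  else (n : ℝ) ^ (-(1 / (r + 1)))

/-- `q_n = √n τ_n`. -/
def rateQ (r : ℝ) (n : ℕ) : ℝ := √(n : ℝ) * rateTau r n

/-- The estimation error bound `L(r, n)` with constants `D₁, D₂` (case `r ≥ 1`) and `D₃, D₄`
(case `r < 1`). -/
def estimationBound (D₁ D₂ D₃ D₄ r : ℝ) (n : ℕ) : ℝ :=
  if 1 ≤ r then 2 * D₁ * rateTau r n + 4 * D₂ * Real.exp (-D₁ ^ 2 * rateQ r n ^ 2)
  else 2 * D₃ * rateTau r n + 2 * (n : ℝ)⁻¹ * D₄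

end

/-! For a step classifier the hinge risk is exactly twice the classification risk
(`hingeRisk_stepClassifier`). Hence `2 (R(f̂) - inf R)` is at most the hinge risk of the step
version of `f̂` minus the infimum over the subclass, which contains all step classifiers. Inserting
`R_h(f̂)` and `inf R_h` over the approximating class splits this into the two stated error terms and
the mean excess hinge risk of the minimizer `f̂`.

That excess needs only a one-sided bound on `(P - Pₙ) g` over the hinge losses `g`, since `Pₙ` is
unbiased at a fixed competitor (`integral_hingeRisk_le_sInf_add`). Replacing `g` by a lower bracket
`l_K` costs at most `P(g - l_K) ≤ 2⁻ᴷ`, and `l_K` is telescoped over the levels `2⁻ᵏ`. A link is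
bounded by 2 with `L₁`-norm of order `2⁻ᵏ`, so its variance has that order too, and a Bernstein
bound (`exists_deviation_le`) controls each finite family of links in mean.

With `ρ = 2^((r-1)/2)` and `β = 2^((r+1)/2)`, level `k` costs a multiple of `ρᵏ/√n`, and the
exponential moment bound is available while `βᵏ ≤ √n`. Stopping at the last such `K` gives `2⁻ᴷ` of
order at most `n^(-1/(r+1))`; the three rates reflect whether `∑ ρᵏ` converges, grows linearly or is
dominated by its last term. Suprema over the class are always replaced by an integrable majorant
`B`, so their measurability never matters. -/

/-! ### Exponential moments and a maximal inequality for finite families. -/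

section MaximalInequality

variable {Z : Type*} [MeasurableSpace Z] {μ : Measure Z}

/-- The deviation `(μ - μₙ) h` of the mean of `h` from its empirical mean on the sample `s`. -/
noncomputable def deviation (μ : Measure Z) {n : ℕ} (s : Fin n → Z) (h : Z → ℝ) : ℝ :=
  ∫ z, h z ∂μ - (1 / (n : ℝ)) * ∑ i, h (s i)

theorem integrable_of_abs_le [IsFiniteMeasure μ] {h : Z → ℝ} (hm : Measurable h) {c : ℝ}
    (hc : ∀ z, |h z| ≤ c) : Integrable h μ :=
  Integrable.of_bound hm.aestronglyMeasurable c (ae_of_all _ hc)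

/-- A Bernstein type bound for the moment generating function of a function bounded by `2`. -/
theorem integral_exp_centered_le [IsProbabilityMeasure μ] {h : Z → ℝ} (hm : Measurable h)
    (hb : ∀ z, |h z| ≤ 2) {δ : ℝ} (hδ : ∫ z, |h z| ∂μ ≤ δ) {t : ℝ} (ht : 0 ≤ t)
    (ht' : t ≤ 1 / 4) :
    ∫ z, Real.exp (t * (∫ w, h w ∂μ - h z)) ∂μ ≤ Real.exp (2 * δ * t ^ 2) := by
  set m := ∫ w, h w ∂μ with hmdef
  have hi : Integrable h μ := integrable_of_abs_le hm hb
  have hia : Integrable (fun z => |h z|) μ := hi.abs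
  have hmb : |m| ≤ 2 := by
    have := norm_integral_le_of_norm_le_const (μ := μ) (f := h) (C := 2) (ae_of_all _ hb)
    simpa using this
  have hx : ∀ z, |t * (m - h z)| ≤ 1 := fun z => by
    have h1 := hb z
    rw [abs_mul, abs_of_nonneg ht]
    have h2 : |m - h z| ≤ 4 := by
      rw [abs_le] at *
      constructor <;> linarith
    nlinarith [abs_nonneg (m - h z)]
  -- From `exp x ≤ 1 + x + x²` for `|x| ≤ 1` and `(m - h)² = 2m(m - h) - m² + h²`, dropping `-m²`
  -- and using `h² ≤ 2|h|`. The term linear in `m - h` integrates to zero.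
  have hpt : ∀ z, Real.exp (t * (m - h z))
      ≤ 1 + (t + 2 * t ^ 2 * m) * (m - h z) + t ^ 2 * (2 * |h z|) := fun z => by
    have h1 := (abs_le.1 (Real.abs_exp_sub_one_sub_id_le (hx z))).2
    have h2 : h z ^ 2 ≤ 2 * |h z| := by
      rw [← sq_abs]
      nlinarith [hb z, abs_nonneg (h z)]
    have h3 : t ^ 2 * h z ^ 2 ≤ t ^ 2 * (2 * |h z|) :=
      mul_le_mul_of_nonneg_left h2 (sq_nonneg t)
    nlinarith [mul_nonneg (sq_nonneg t) (sq_nonneg m)]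
  have hie : Integrable (fun z => Real.exp (t * (m - h z))) μ :=
    integrable_of_abs_le (by fun_prop) (c := Real.exp 1) fun z => by
      rw [abs_of_pos (Real.exp_pos _)]
      exact Real.exp_le_exp.2 (abs_le.1 (hx z)).2
  have i1 : Integrable (fun z => (t + 2 * t ^ 2 * m) * (m - h z)) μ :=
    ((integrable_const m).sub hi).const_mul _
  have i2 : Integrable (fun z => t ^ 2 * (2 * |h z|)) μ := (hia.const_mul 2).const_mul _
  have i3 : Integrable (fun z => 1 + (t + 2 * t ^ 2 * m) * (m - h z)) μ :=
    (integrable_const (1 : ℝ)).add i1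
  calc ∫ z, Real.exp (t * (m - h z)) ∂μ
      ≤ ∫ z, (1 + (t + 2 * t ^ 2 * m) * (m - h z) + t ^ 2 * (2 * |h z|)) ∂μ :=
        integral_mono hie (i3.add i2) hpt
    _ = 1 + t ^ 2 * (2 * ∫ z, |h z| ∂μ) := by
        rw [integral_add i3 i2, integral_add (integrable_const _) i1, integral_const_mul,
          integral_const_mul, integral_const_mul, integral_sub (integrable_const _) hi]
        simp [← hmdef]
    _ ≤ 2 * δ * t ^ 2 + 1 := by nlinarith [sq_nonneg t]
    _ ≤ _ := Real.add_one_le_exp _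

/-- Maximal inequality: the deviations of a finite family of functions with values in `[-2, 2]`
are dominated by a function of the sample with a small mean. -/
theorem exists_deviation_le [IsProbabilityMeasure μ] {ι : Type*} [Fintype ι] (h : ι → Z → ℝ)
    (hm : ∀ j, Measurable (h j)) (hb : ∀ j z, |h j z| ≤ 2) {δ : ℝ}
    (hδ : ∀ j, ∫ z, |h j z| ∂μ ≤ δ) {H : ℝ} (hH : (Fintype.card ι : ℝ) ≤ Real.exp H)
    {n : ℕ} (hn : 0 < n) {t : ℝ} (ht : 0 < t) (ht' : t ≤ 1 / 4) :
    ∃ B : (Fin n → Z) → ℝ, Integrable B (Measure.pi fun _ => μ) ∧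
      (∀ s j, deviation μ s (h j) ≤ B s) ∧
      ∫ s, B s ∂(Measure.pi fun _ => μ) ≤ H / (n * t) + 2 * δ * t := by
  have hn' : (0 : ℝ) < n := by exact_mod_cast hn
  set e : ι → (Fin n → Z) → ℝ := fun j s =>
    ∏ i, Real.exp (t * (∫ w, h j w ∂μ - h j (s i))) with he
  have hmb : ∀ j, |∫ w, h j w ∂μ| ≤ 2 := fun j => by
    have := norm_integral_le_of_norm_le_const (μ := μ) (f := h j) (C := 2) (ae_of_all _ (hb j))
    simpa using this
  have hei : ∀ j, Integrable (e j) (Measure.pi fun _ => μ) := fun j => by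
    refine Integrable.fintype_prod (f := fun _ z => Real.exp (t * (∫ w, h j w ∂μ - h j z)))
      fun _ => integrable_of_abs_le (by have := hm j; fun_prop) (c := Real.exp 1) fun z => ?_
    rw [abs_of_pos (Real.exp_pos _)]
    have h1 := abs_le.1 (hb j z)
    have h2 := abs_le.1 (hmb j)
    exact Real.exp_le_exp.2 (by nlinarith)
  have heI : ∀ j, ∫ s, e j s ∂(Measure.pi fun _ => μ) ≤ Real.exp (n * (2 * δ * t ^ 2)) :=
    fun j => by
    rw [he, integral_fintype_prod_eq_pow (fun z => Real.exp (t * (∫ w, h j w ∂μ - h j z))),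
      Fintype.card_fin, Real.exp_nat_mul]
    exact pow_le_pow_left₀ (integral_nonneg fun _ => (Real.exp_pos _).le)
      (integral_exp_centered_le (hm j) (hb j) (hδ j) ht.le ht') n
  have hes : ∀ j s, e j s = Real.exp (n * t * deviation μ s (h j)) := fun j s => by
    rw [he]
    simp only
    rw [← Real.exp_sum, ← Finset.mul_sum, Finset.sum_sub_distrib, deviation]
    congr 1
    simp
    field_simp
  set b : ℝ := H + n * (2 * δ * t ^ 2) with hbdef
  have hSi : Integrable (fun s => ∑ j, e j s) (Measure.pi fun _ : Fin n => μ) :=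
    integrable_finsetSum _ fun j _ => hei j
  have hSi' : Integrable (fun s => (∑ j, e j s) / Real.exp b - 1)
      (Measure.pi fun _ : Fin n => μ) := (hSi.div_const _).sub (integrable_const _)
  -- The maximum is below `(1/(nt)) log ∑ e j`; the logarithm is replaced by its tangent at `exp b`,
  -- which bounds the mean of the sum. This takes the place of Jensen's inequality.
  refine ⟨fun s => 1 / (n * t) * ((∑ j, e j s) / Real.exp b - 1 + b),
    (hSi'.add (integrable_const _)).const_mul _, ?_, ?_⟩
  · intro s j
    have h1 : e j s ≤ ∑ j, e j s :=
      Finset.single_le_sum (f := fun j => e j s) (fun j _ => by rw [hes]; exact (Real.exp_pos _).le)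
        (Finset.mem_univ j)
    have h2 := Real.add_one_le_exp (n * t * deviation μ s (h j) - b)
    rw [Real.exp_sub, ← hes] at h2
    have h3 : e j s / Real.exp b ≤ (∑ j, e j s) / Real.exp b :=
      div_le_div_of_nonneg_right h1 (Real.exp_pos _).le
    change _ ≤ 1 / (n * t) * ((∑ j, e j s) / Real.exp b - 1 + b)
    rw [one_div, ← div_eq_inv_mul, le_div_iff₀ (by positivity)]
    linarith
  · have h1 : ∑ j, ∫ s, e j s ∂(Measure.pi fun _ => μ) ≤ Real.exp b := by
      calc ∑ j, ∫ s, e j s ∂(Measure.pi fun _ => μ)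
          ≤ ∑ _j : ι, Real.exp (n * (2 * δ * t ^ 2)) := Finset.sum_le_sum fun j _ => heI j
        _ = Fintype.card ι * Real.exp (n * (2 * δ * t ^ 2)) := by simp
        _ ≤ Real.exp H * Real.exp (n * (2 * δ * t ^ 2)) := by gcongr
        _ = _ := by rw [← Real.exp_add]
    rw [integral_const_mul, integral_add hSi' (integrable_const _), integral_sub (hSi.div_const _) (integrable_const _),
      integral_div, integral_finsetSum _ fun j _ => hei j]
    have h2 := (div_le_one (Real.exp_pos b)).2 h1
    simp only [integral_const, probReal_univ, one_smul]
    calc _ ≤ 1 / (n * t) * b := by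
          gcongr
          linarith
      _ = _ := by
          rw [hbdef]
          field_simp

end MaximalInequality

/-! ### Chaining along lower brackets. -/

section Chaining

variable {Z : Type*} [MeasurableSpace Z] {μ : Measure Z}

theorem deviation_add [IsFiniteMeasure μ] {n : ℕ} (s : Fin n → Z) {g h : Z → ℝ}
    (hg : Integrable g μ) (hh : Integrable h μ) :
    deviation μ s (fun z => g z + h z) = deviation μ s g + deviation μ s h := by
  simp only [deviation, integral_add hg hh, Finset.sum_add_distrib]
  ring

/-- The family `l` consists of lower brackets for the class `𝓒`, at `L₁(μ)`-distance at most `ε`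
and with values in `[0, 2]`. -/
def IsLowerCover (μ : Measure Z) (𝓒 : Set (Z → ℝ)) (ε : ℝ) {k : ℕ} (l : Fin k → Z → ℝ) : Prop :=
  (∀ j, Measurable (l j) ∧ ∀ z, l j z ∈ Set.Icc (0 : ℝ) 2) ∧
    ∀ g ∈ 𝓒, ∃ j, (∀ z, l j z ≤ g z) ∧ ∫ z, (g z - l j z) ∂μ ≤ ε

/-- Chaining along lower brackets, up to the resolution `2⁻ᴷ = (ρ / β) ^ K`. -/
theorem exists_lower_bracket_deviation_le [IsProbabilityMeasure μ] {𝓒 : Set (Z → ℝ)}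
    (h𝓒 : ∀ g ∈ 𝓒, Measurable g ∧ ∀ z, g z ∈ Set.Icc (0 : ℝ) 2) {C ρ β : ℝ} (hC : 0 < C)
    (hρ : 0 < ρ) (hβ : 1 < β) (hρβ : β = 2 * ρ) (hρβ' : 1 ≤ ρ * β) {N : ℕ → ℕ} {l : ∀ k, Fin (N k) → Z → ℝ}
    (hl : ∀ k, IsLowerCover μ 𝓒 ((1 / 2) ^ k) (l k))
    (hN : ∀ k, (N k : ℝ) ≤ Real.exp (C * (ρ * β) ^ k)) {n : ℕ} (hn : 0 < n) (K : ℕ)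
    (hK : β ^ K ≤ √(n : ℝ)) :
    ∃ B : (Fin n → Z) → ℝ, Integrable B (Measure.pi fun _ => μ) ∧
      (∀ g ∈ 𝓒, ∀ j, (∀ z, l K j z ≤ g z) → ∫ z, (g z - l K j z) ∂μ ≤ (1 / 2) ^ K →
        ∀ s, deviation μ s (l K j) ≤ B s) ∧
      ∫ s, B s ∂(Measure.pi fun _ => μ)
        ≤ (8 * C + 2) * (∑ k ∈ Finset.range (K + 1), ρ ^ k) / √(n : ℝ) := by
  have hn' : (0 : ℝ) < n := by exact_mod_cast hn
  have hq : 0 < √(n : ℝ) := Real.sqrt_pos.2 hn'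
  have hqq : (n : ℝ) = √(n : ℝ) * √(n : ℝ) := (Real.mul_self_sqrt hn'.le).symm
  have hli : ∀ k j, Integrable (l k j) μ := fun k j =>
    integrable_of_abs_le ((hl k).1 j).1 (c := 2) fun z => by
      have := ((hl k).1 j).2 z
      rw [abs_of_nonneg this.1]
      exact this.2
  have hgi : ∀ g ∈ 𝓒, Integrable g μ := fun g hg =>
    integrable_of_abs_le (h𝓒 g hg).1 (c := 2) fun z => by
      have := (h𝓒 g hg).2 z
      rw [abs_of_nonneg this.1]
      exact this.2
  induction K with
  | zero =>
    have h1 : 1 ≤ √(n : ℝ) := by simpa using hK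
    obtain ⟨B, hB, hle, hI⟩ := exists_deviation_le (μ := μ) (l 0) (fun j => ((hl 0).1 j).1)
      (fun j z => by
        have := ((hl 0).1 j).2 z
        rw [abs_of_nonneg this.1]
        exact this.2) (δ := 2) (fun j => by
          have h2 : ∀ z, |l 0 j z| ≤ 2 := fun z => by
            have := ((hl 0).1 j).2 z
            rw [abs_of_nonneg this.1]
            exact this.2
          calc ∫ z, |l 0 j z| ∂μ ≤ ∫ _, (2 : ℝ) ∂μ :=
                integral_mono (hli 0 j).abs (integrable_const _) h2
            _ = 2 := by simp) (H := C) (by simpa using hN 0) hn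
      (t := 1 / (4 * √(n : ℝ))) (by positivity) (by
        rw [div_le_div_iff₀ (by positivity) (by norm_num)]
        linarith)
    refine ⟨B, hB, fun g _ j _ _ s => hle s j, hI.trans ?_⟩
    have : C / (n * (1 / (4 * √(n : ℝ)))) + 2 * 2 * (1 / (4 * √(n : ℝ)))
        = (4 * C + 1) / √(n : ℝ) := by
      rw [hqq]
      simp only [Real.sqrt_mul_self hq.le]
      field_simp
      ring
    rw [this]
    simp only [zero_add, Finset.range_one, Finset.sum_singleton, pow_zero, mul_one]
    gcongr <;> linarith
  | succ K ih =>
    obtain ⟨B₀, hB₀, hle₀, hI₀⟩ := ih ((pow_le_pow_right₀ hβ.le K.le_succ).trans hK)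
    classical
    let ι := {p : Fin (N (K + 1)) × Fin (N K) //
      -- Two lower brackets of the same `g` at consecutive levels differ by at most `2⁻⁽ᴷ⁺¹⁾ + 2⁻ᴷ`
      -- in `L₁`, so every link that is used lies in this finite family.
      ∫ z, |l (K + 1) p.1 z - l K p.2 z| ∂μ ≤ 3 * (1 / 2) ^ (K + 1)}
    have hcard : (Fintype.card ι : ℝ) ≤ Real.exp (2 * C * (ρ * β) ^ (K + 1)) := by
      have h1 : (Fintype.card ι : ℝ) ≤ N (K + 1) * N K := by
        have := Fintype.card_subtype_le (fun p : Fin (N (K + 1)) × Fin (N K) =>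
          ∫ z, |l (K + 1) p.1 z - l K p.2 z| ∂μ ≤ 3 * (1 / 2) ^ (K + 1))
        rw [Fintype.card_prod, Fintype.card_fin, Fintype.card_fin] at this
        exact_mod_cast this
      calc (Fintype.card ι : ℝ) ≤ N (K + 1) * N K := h1
        _ ≤ Real.exp (C * (ρ * β) ^ (K + 1)) * Real.exp (C * (ρ * β) ^ K) :=
            mul_le_mul (hN _) (hN _) (Nat.cast_nonneg _) (Real.exp_pos _).le
        _ ≤ Real.exp (2 * C * (ρ * β) ^ (K + 1)) := by
            rw [← Real.exp_add, Real.exp_le_exp]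
            have := mul_le_mul_of_nonneg_left (pow_le_pow_right₀ hρβ' (Nat.le_add_right K 1)) hC.le
            linarith
    obtain ⟨B, hB, hle, hI⟩ := exists_deviation_le (μ := μ)
      (fun (p : ι) z => l (K + 1) p.1.1 z - l K p.1.2 z)
      (fun p => ((hl _).1 _).1.sub ((hl _).1 _).1)
      (fun p z => by
        have h1 := ((hl (K + 1)).1 p.1.1).2 z
        have h2 := ((hl K).1 p.1.2).2 z
        rw [abs_le]
        constructor <;> linarith [h1.1, h1.2, h2.1, h2.2])
      -- This `t` balances the entropy term `H/(nt)` against the variance term `2δt`: since `β =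
      -- 2ρ`, both become multiples of `ρ^(K+1)/√n`. The requirement `t ≤ 1/4` is exactly `β^(K+1) ≤
      -- √n`.
      (fun p => p.2) hcard hn (t := β ^ (K + 1) / (4 * √(n : ℝ))) (by positivity) (by
        rw [div_le_div_iff₀ (by positivity) (by norm_num)]
        linarith)
    refine ⟨fun s => B₀ s + B s, hB₀.add hB, ?_, ?_⟩
    · intro g hg j hj hjI s
      obtain ⟨i, hi, hiI⟩ := (hl K).2 g hg
      have hij : ∫ z, |l (K + 1) j z - l K i z| ∂μ ≤ 3 * (1 / 2) ^ (K + 1) := by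
        have i1 := (hgi g hg).sub (hli (K + 1) j)
        have i2 := (hgi g hg).sub (hli K i)
        calc ∫ z, |l (K + 1) j z - l K i z| ∂μ
            ≤ ∫ z, ((g z - l (K + 1) j z) + (g z - l K i z)) ∂μ := by
              refine integral_mono ((hli _ _).sub (hli _ _)).abs (i1.add i2) fun z => ?_
              simp only [abs_le]
              constructor <;> linarith [hj z, hi z]
          _ = ∫ z, (g z - l (K + 1) j z) ∂μ + ∫ z, (g z - l K i z) ∂μ := integral_add i1 i2
          _ ≤ (1 / 2) ^ (K + 1) + (1 / 2) ^ K := add_le_add hjI hiI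
          _ = _ := by ring
      have h1 := hle₀ g hg i hi hiI s
      have h2 := hle s ⟨(j, i), hij⟩
      have h3 := deviation_add (μ := μ) s (hli K i) ((hli (K + 1) j).sub (hli K i))
      simp only [Pi.sub_apply, add_sub_cancel] at h3
      rw [show l (K + 1) j = fun z => l (K + 1) j z from rfl, h3]
      exact add_le_add h1 h2
    · rw [integral_add hB₀ hB, Finset.sum_range_succ, mul_add, add_div]
      refine add_le_add hI₀ (hI.trans ?_)
      have h1 : 2 * C * (ρ * β) ^ (K + 1) / (n * (β ^ (K + 1) / (4 * √(n : ℝ))))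
          + 2 * (3 * (1 / 2) ^ (K + 1)) * (β ^ (K + 1) / (4 * √(n : ℝ)))
          = (8 * C + 3 / 2) * ρ ^ (K + 1) / √(n : ℝ) := by
        have h2 : β ^ (K + 1) = 2 ^ (K + 1) * ρ ^ (K + 1) := by rw [hρβ, mul_pow]
        have h3 : (n : ℝ) * (β ^ (K + 1) / (4 * √(n : ℝ))) = √(n : ℝ) * β ^ (K + 1) / 4 := by
          nth_rw 1 [hqq]
          field_simp
        rw [h3, mul_pow, h2, div_pow, one_pow]
        field_simp
        ring
      rw [h1]
      gcongr
      norm_num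

/-- Uniform one-sided deviation bound for a class with small lower brackets. -/
theorem exists_uniform_deviation_le [IsProbabilityMeasure μ] {𝓒 : Set (Z → ℝ)}
    (h𝓒 : ∀ g ∈ 𝓒, Measurable g ∧ ∀ z, g z ∈ Set.Icc (0 : ℝ) 2) {C ρ β : ℝ} (hC : 0 < C)
    (hρ : 0 < ρ) (hβ : 1 < β) (hρβ : β = 2 * ρ) (hρβ' : 1 ≤ ρ * β) {N : ℕ → ℕ} {l : ∀ k, Fin (N k) → Z → ℝ}
    (hl : ∀ k, IsLowerCover μ 𝓒 ((1 / 2) ^ k) (l k))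
    (hN : ∀ k, (N k : ℝ) ≤ Real.exp (C * (ρ * β) ^ k)) {n : ℕ} (hn : 0 < n) (K : ℕ)
    (hK : β ^ K ≤ √(n : ℝ)) :
    ∃ B : (Fin n → Z) → ℝ, Integrable B (Measure.pi fun _ => μ) ∧
      (∀ g ∈ 𝓒, ∀ s, deviation μ s g ≤ B s) ∧
      ∫ s, B s ∂(Measure.pi fun _ => μ)
        ≤ (8 * C + 2) * (∑ k ∈ Finset.range (K + 1), ρ ^ k) / √(n : ℝ) + (1 / 2) ^ K := by
  obtain ⟨B, hB, hle, hI⟩ :=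
    exists_lower_bracket_deviation_le h𝓒 hC hρ hβ hρβ hρβ' hl hN hn K hK
  refine ⟨fun s => B s + (1 / 2) ^ K, hB.add (integrable_const _), fun g hg s => ?_, ?_⟩
  · obtain ⟨j, hj, hjI⟩ := (hl K).2 g hg
    have hli : Integrable (l K j) μ :=
      integrable_of_abs_le ((hl K).1 j).1 (c := 2) fun z => by
        have := ((hl K).1 j).2 z
        rw [abs_of_nonneg this.1]
        exact this.2
    have hgi : Integrable g μ :=
      integrable_of_abs_le (h𝓒 g hg).1 (c := 2) fun z => by
        have := (h𝓒 g hg).2 z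
        rw [abs_of_nonneg this.1]
        exact this.2
    refine le_trans ?_ (add_le_add_left (hle g hg j hj hjI s) _)
    rw [integral_sub hgi hli] at hjI
    -- Because `l ≤ g` everywhere, passing from `g` to its lower bracket costs nothing on the
    -- empirical side and only `∫ (g - l)` on the population side.
    have h1 : (1 / (n : ℝ)) * ∑ i, l K j (s i) ≤ (1 / (n : ℝ)) * ∑ i, g (s i) := by
      gcongr with i
      exact hj _
    simp only [deviation]
    linarith
  · rw [integral_add hB (integrable_const _)]
    simpa using hI

end Chaining

/-! ### Hinge risk versus classification risk, and brackets for hinge losses. -/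

section Risk

theorem Label.eq_one_or (y : Label) : (y : ℝ) = 1 ∨ (y : ℝ) = -1 := by
  rcases y.2 with h | h
  · exact Or.inr h
  · exact Or.inl h

theorem sgn_eq_one_or (a : ℝ) : sgn a = 1 ∨ sgn a = -1 := by
  unfold sgn
  split_ifs <;> simp

/-- On `[-1, 1]` the truncation at zero is inactive, so the loss is affine in the classifier and
brackets transfer without loss. -/
theorem hingeLoss_label_mul (y : Label) {a : ℝ} (ha : a ∈ Set.Icc (-1 : ℝ) 1) :
    hingeLoss (y * a) = 1 - y * a := by
  refine max_eq_right ?_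
  rcases Label.eq_one_or y with h | h <;> rw [h] <;> linarith [ha.1, ha.2]

theorem hingeLoss_label_mul_mem (y : Label) {a : ℝ} (ha : a ∈ Set.Icc (-1 : ℝ) 1) :
    hingeLoss (y * a) ∈ Set.Icc (0 : ℝ) 2 := by
  rw [hingeLoss_label_mul y ha]
  rcases Label.eq_one_or y with h | h <;> rw [h] <;> constructor <;> linarith [ha.1, ha.2]

theorem hingeLoss_nonneg (a : ℝ) : 0 ≤ hingeLoss a := le_max_left _ _

theorem stepClassifier_predictionSet {𝒳 : Type u} (f : 𝒳 → ℝ) (x : 𝒳) :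
    stepClassifier (predictionSet f) x = sgn (f x) := by
  by_cases h : 0 ≤ f x
  · have hx : x ∈ predictionSet f := h
    simp only [stepClassifier, Set.indicator_of_mem hx, sgn, if_pos h]
    norm_num
  · have hx : x ∉ predictionSet f := h
    simp [stepClassifier, Set.indicator_of_notMem hx, sgn, if_neg h]

variable {𝒳 : Type u} [MeasurableSpace 𝒳]

theorem measurable_sgn_comp {f : 𝒳 → ℝ} (hf : MeasurableSet (predictionSet f)) :
    Measurable fun x => sgn (f x) := by
  simp_rw [← stepClassifier_predictionSet f]
  exact ((measurable_const.indicator hf).const_mul 2).sub_const 1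

/-- The hinge risk of a step classifier is twice its classification risk. -/
theorem hingeRisk_stepClassifier {P : Measure (Label × 𝒳)} {f : 𝒳 → ℝ}
    (hf : MeasurableSet (predictionSet f)) :
    hingeRisk P (stepClassifier (predictionSet f)) = 2 * classificationRisk P f := by
  have hs : MeasurableSet {z : Label × 𝒳 | sgn (f z.2) ≠ (z.1 : ℝ)} :=
    (measurableSet_eq_fun ((measurable_sgn_comp hf).comp measurable_snd)
      (measurable_subtype_coe.comp measurable_fst)).compl
  rw [classificationRisk, ← integral_indicator_one hs, ← integral_const_mul, hingeRisk]
  congr 1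
  ext z
  rw [stepClassifier_predictionSet]
  by_cases h : sgn (f z.2) = (z.1 : ℝ)
  · rw [Set.indicator_of_notMem (by simpa using h), h]
    rcases Label.eq_one_or z.1 with h1 | h1 <;> rw [h1] <;> norm_num [hingeLoss]
  · rw [Set.indicator_of_mem (by simpa using h)]
    rcases Label.eq_one_or z.1 with h1 | h1 <;> rcases sgn_eq_one_or (f z.2) with h2 | h2 <;>
      rw [h1, h2] at h ⊢ <;>
        first | exact absurd rfl h | norm_num [hingeLoss]

theorem hingeRisk_nonneg (P : Measure (Label × 𝒳)) (f : 𝒳 → ℝ) : 0 ≤ hingeRisk P f :=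
  integral_nonneg fun _ => hingeLoss_nonneg _

theorem bddBelow_hingeRisk (P : Measure (Label × 𝒳)) (F : Set (𝒳 → ℝ)) :
    BddBelow (hingeRisk P '' F) := by
  refine ⟨0, ?_⟩
  rintro _ ⟨f, -, rfl⟩
  exact hingeRisk_nonneg P f

/-- Each constrained `f` has a step version in `F` whose hinge risk is twice the classification risk
of `f`. -/
theorem sInf_hingeRisk_le_two_mul_sInf_classificationRisk {P : Measure (Label × 𝒳)}
    {𝒢 : Set (Set 𝒳)} (h𝒢 : 𝒢.Nonempty) (hm : ∀ G ∈ 𝒢, MeasurableSet G) {F : Set (𝒳 → ℝ)}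
    (hF : ∀ G ∈ 𝒢, stepClassifier G ∈ F) (hF' : F ⊆ constrainedClass 𝒢) :
    sInf (hingeRisk P '' F) ≤ 2 * sInf (classificationRisk P '' constrainedClass 𝒢) := by
  have hne : (classificationRisk P '' constrainedClass 𝒢).Nonempty :=
    let ⟨G, hG⟩ := h𝒢
    ⟨_, _, hF' (hF G hG), rfl⟩
  have : sInf (hingeRisk P '' F) / 2 ≤ sInf (classificationRisk P '' constrainedClass 𝒢) := by
    refine le_csInf hne ?_
    rintro _ ⟨f, hf, rfl⟩
    have h1 := csInf_le (bddBelow_hingeRisk P F) ⟨_, hF _ hf.1, rfl⟩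
    rw [hingeRisk_stepClassifier (hm _ hf.1)] at h1
    linarith
  linarith

/-- The class of hinge losses `(y, x) ↦ max {0, 1 - y f x}` of the members of `F`. -/
def hingeClass (F : Set (𝒳 → ℝ)) : Set (Label × 𝒳 → ℝ) :=
  (fun f z => hingeLoss ((z.1 : ℝ) * f z.2)) '' F

theorem measurable_hingeLoss_label_mul {f : 𝒳 → ℝ} (hf : Measurable f) :
    Measurable fun z : Label × 𝒳 => hingeLoss ((z.1 : ℝ) * f z.2) := by
  have h1 : Measurable fun z : Label × 𝒳 => (z.1 : ℝ) :=
    measurable_subtype_coe.comp measurable_fst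
  exact measurable_const.max (measurable_const.sub (h1.mul (hf.comp measurable_snd)))

/-- A real entropy bound excludes the value `⊤`, and a finite infimum in `ℕ∞` is attained. -/
theorem exists_isBracketCover_of_bracketingEntropy_le {p : ℝ≥0∞} {ε : ℝ} {F : Set (𝒳 → ℝ)}
    {Q : Measure 𝒳} {H : ℝ} (h : bracketingEntropy p ε F Q ≤ (H : EReal)) :
    ∃ k, IsBracketCover p ε F Q k ∧ (k : ℝ) ≤ Real.exp H := by
  have h1 : ((bracketingNumber p ε F Q : ℕ∞) : ℝ≥0∞) ≤ ENNReal.ofReal (Real.exp H) := by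
    rw [← ENNReal.log_le_log_iff, ← EReal.exp_coe, EReal.log_exp]
    exact h
  have h2 : bracketingNumber p ε F Q ≠ ⊤ := fun h => by
    rw [h] at h1
    simp at h1
  obtain ⟨m, hm⟩ := ENat.ne_top_iff_exists.1 h2
  have h3 : bracketingNumber p ε F Q < ((m + 1 : ℕ) : ℕ∞) := by
    rw [← hm]
    exact_mod_cast m.lt_succ_self
  obtain ⟨k, hk⟩ := iInf_lt_iff.1 h3
  obtain ⟨hc, hk⟩ := iInf_lt_iff.1 hk
  refine ⟨k, hc, ?_⟩
  have hkm : k ≤ m := Nat.lt_succ_iff.1 (by exact_mod_cast hk)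
  rw [← hm] at h1
  have h4 : (m : ℝ) ≤ Real.exp H := by
    have h5 : ((m : ℕ) : ℝ≥0∞) ≤ ENNReal.ofReal (Real.exp H) := by simpa using h1
    rw [← ENNReal.ofReal_natCast, ENNReal.ofReal_le_ofReal_iff (Real.exp_pos _).le] at h5
    exact h5
  exact le_trans (by exact_mod_cast hkm) h4

/-- Brackets for a class of classifiers yield lower brackets for the hinge losses. -/
theorem exists_isLowerCover_hingeClass {P : Measure (Label × 𝒳)} [IsProbabilityMeasure P]
    {F : Set (𝒳 → ℝ)} (hF : ∀ f ∈ F, Measurable f ∧ ∀ x, f x ∈ Set.Icc (-1 : ℝ) 1) {ε : ℝ}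
    (hε : 0 < ε) {k : ℕ} (h : IsBracketCover 1 ε F P.snd k) :
    ∃ l : Fin k → Label × 𝒳 → ℝ, IsLowerCover P (hingeClass F) ε l := by
  obtain ⟨a, b, hab, hcov⟩ := h
  have hy : Measurable fun z : Label × 𝒳 => (z.1 : ℝ) :=
    measurable_subtype_coe.comp measurable_fst
  -- For `a ≤ f ≤ b` the maximum of `y a` and `y b` bounds `y f` for either label, so one minus it
  -- lies below the loss. Clipping to `[0, 2]` supplies the boundedness that chaining needs.
  have hlm : ∀ j, Measurable fun z : Label × 𝒳 =>
      max 0 (min 2 (1 - max ((z.1 : ℝ) * a j z.2) ((z.1 : ℝ) * b j z.2))) := fun j =>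
    measurable_const.max (measurable_const.min (measurable_const.sub
      ((hy.mul ((hab j).1.comp measurable_snd)).max
        (hy.mul ((hab j).2.1.comp measurable_snd)))))
  have hlb : ∀ j (z : Label × 𝒳),
      max 0 (min 2 (1 - max ((z.1 : ℝ) * a j z.2) ((z.1 : ℝ) * b j z.2))) ∈ Set.Icc (0 : ℝ) 2 :=
    fun j z => ⟨le_max_left _ _, max_le (by norm_num) (min_le_left _ _)⟩
  refine ⟨fun j z => max 0 (min 2 (1 - max ((z.1 : ℝ) * a j z.2) ((z.1 : ℝ) * b j z.2))),
    fun j => ⟨hlm j, hlb j⟩, ?_⟩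
  rintro _ ⟨f, hf, rfl⟩
  obtain ⟨j, hj⟩ := hcov f hf
  have hg := fun z : Label × 𝒳 => hingeLoss_label_mul_mem z.1 ((hF f hf).2 z.2)
  have hge : ∀ z : Label × 𝒳, hingeLoss ((z.1 : ℝ) * f z.2) = 1 - z.1 * f z.2 :=
    fun z => hingeLoss_label_mul z.1 ((hF f hf).2 z.2)
  have hle : ∀ z : Label × 𝒳,
      1 - max ((z.1 : ℝ) * a j z.2) ((z.1 : ℝ) * b j z.2) ≤ 1 - z.1 * f z.2 := fun z => by
    rcases Label.eq_one_or z.1 with h1 | h1 <;> rw [h1]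
    · linarith [(hj z.2).2, le_max_right (1 * a j z.2) (1 * b j z.2)]
    · linarith [(hj z.2).1, le_max_left (-1 * a j z.2) (-1 * b j z.2)]
  refine ⟨j, fun z => ?_, ?_⟩
  · refine max_le (hg z).1 ((min_le_right _ _).trans ?_)
    change _ ≤ hingeLoss ((z.1 : ℝ) * f z.2)
    rw [hge]
    exact hle z
  · have hsm : Measurable fun x => b j x - a j x := (hab j).2.1.sub (hab j).1
    have hd : Integrable (fun x => b j x - a j x) P.snd :=
      memLp_one_iff_integrable.1 ⟨hsm.aestronglyMeasurable, (hab j).2.2.2.trans (by simp)⟩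
    have hI : ∫ x, (b j x - a j x) ∂P.snd ≤ ε := by
      have h1 := (hab j).2.2.2
      rw [eLpNorm_one_eq_lintegral_enorm, ← ofReal_integral_norm_eq_lintegral_enorm hd,
        ENNReal.ofReal_lt_ofReal_iff hε] at h1
      refine le_trans (le_of_eq ?_) h1.le
      congr 1
      ext x
      rw [Real.norm_of_nonneg (sub_nonneg.2 ((hab j).2.2.1 x))]
    have hd' : Integrable (fun z : Label × 𝒳 => b j z.2 - a j z.2) P :=
      (integrable_map_measure hsm.aestronglyMeasurable measurable_snd.aemeasurable).1 hd
    have hI' : ∫ z : Label × 𝒳, (b j z.2 - a j z.2) ∂P ≤ ε := by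
      rw [Measure.snd, integral_map measurable_snd.aemeasurable hsm.aestronglyMeasurable] at hI
      exact hI
    refine le_trans (integral_mono ?_ hd' fun z => ?_) hI'
    · refine Integrable.sub ?_ ?_
      · exact integrable_of_abs_le (measurable_hingeLoss_label_mul (hF f hf).1) (c := 2)
          fun z => by
            rw [abs_of_nonneg (hg z).1]
            exact (hg z).2
      · exact integrable_of_abs_le (hlm j) (c := 2) fun z => by
          rw [abs_of_nonneg (hlb j z).1]
          exact (hlb j z).2
    · have h2 : 1 - max ((z.1 : ℝ) * a j z.2) ((z.1 : ℝ) * b j z.2)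
          ≤ max 0 (min 2 (1 - max ((z.1 : ℝ) * a j z.2) ((z.1 : ℝ) * b j z.2))) := by
        rw [min_eq_right]
        · exact le_max_right _ _
        · have := (hg z).2
          rw [hge] at this
          exact (hle z).trans this
      change hingeLoss ((z.1 : ℝ) * f z.2) - _ ≤ _
      rw [hge]
      have h3 : max ((z.1 : ℝ) * a j z.2) ((z.1 : ℝ) * b j z.2) - z.1 * f z.2
          ≤ b j z.2 - a j z.2 := by
        rw [sub_le_iff_le_add]
        have := hj z.2
        rcases Label.eq_one_or z.1 with h1 | h1 <;> rw [h1] <;>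
          exact max_le (by linarith) (by linarith)
      linarith

end Risk

/-! ### Stopping level and rates. -/

section Rates

/-- Raising the hypothesis to the power `2/(r+1)` turns `β` into 2 and `√n` into `n^(1/(r+1))`. This
bounds the bracketing error left at the stopping level. -/
theorem half_pow_le_of_sqrt_lt {r : ℝ} (hr : 0 < r) {n : ℕ} (hn : 0 < n) {K : ℕ}
    (hK : √(n : ℝ) < ((2 : ℝ) ^ ((r + 1) / 2)) ^ (K + 1)) :
    (1 / 2 : ℝ) ^ K ≤ 2 * (n : ℝ) ^ (-(1 / (r + 1))) := by
  have hn' : (0 : ℝ) < n := by exact_mod_cast hn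
  have h1 : (n : ℝ) ^ (1 / (r + 1)) ≤ 2 ^ (K + 1) := by
    have h2 := Real.rpow_le_rpow (Real.sqrt_nonneg _) hK.le (z := 2 / (r + 1)) (by positivity)
    rw [Real.sqrt_eq_rpow, ← Real.rpow_natCast, ← Real.rpow_mul (by positivity),
      ← Real.rpow_mul (by positivity), ← Real.rpow_mul (by positivity)] at h2
    rw [show 1 / 2 * (2 / (r + 1)) = 1 / (r + 1) by field_simp,
      show (r + 1) / 2 * (((K + 1 : ℕ) : ℝ) * (2 / (r + 1))) = ((K + 1 : ℕ) : ℝ) by field_simp,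
      Real.rpow_natCast] at h2
    exact h2
  rw [Real.rpow_neg hn'.le, one_div, inv_pow, ← div_eq_mul_inv, le_div_iff₀ (by positivity)]
  rw [pow_succ] at h1
  rw [inv_mul_le_iff₀ (by positivity)]
  exact h1

/-- For `r > 1` the ratio `ρ` exceeds 1 and the last term dominates; since `β^((r-1)/(r+1)) = ρ`,
the hypothesis gives `ρᴷ ≤ √n · n^(-1/(r+1))`. -/
theorem geom_sum_le_of_pow_le_sqrt {r : ℝ} (hr : 1 < r) {n : ℕ} (hn : 0 < n) {K : ℕ}
    (hK : ((2 : ℝ) ^ ((r + 1) / 2)) ^ K ≤ √(n : ℝ)) :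
    (∑ k ∈ Finset.range (K + 1), ((2 : ℝ) ^ ((r - 1) / 2)) ^ k) / √(n : ℝ)
      ≤ (2 : ℝ) ^ ((r - 1) / 2) / ((2 : ℝ) ^ ((r - 1) / 2) - 1) * (n : ℝ) ^ (-(1 / (r + 1))) := by
  have hn' : (0 : ℝ) < n := by exact_mod_cast hn
  have hr1 : 0 < r + 1 := by linarith
  have hρ : 1 < (2 : ℝ) ^ ((r - 1) / 2) := Real.one_lt_rpow (by norm_num) (by linarith)
  have h1 : ((2 : ℝ) ^ ((r - 1) / 2)) ^ K ≤ (n : ℝ) ^ ((r - 1) / (2 * (r + 1))) := by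
    have h2 := Real.rpow_le_rpow (by positivity) hK (z := (r - 1) / (r + 1))
      (div_nonneg (by linarith) hr1.le)
    rw [Real.sqrt_eq_rpow, ← Real.rpow_natCast, ← Real.rpow_mul (by positivity),
      ← Real.rpow_mul (by positivity), ← Real.rpow_mul (by positivity)] at h2
    rw [← Real.rpow_natCast, ← Real.rpow_mul (by norm_num)]
    convert h2 using 2 <;> field_simp
  have h3 : (n : ℝ) ^ ((r - 1) / (2 * (r + 1))) = (n : ℝ) ^ (-(1 / (r + 1))) * √(n : ℝ) := by
    rw [Real.sqrt_eq_rpow, ← Real.rpow_add hn']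
    congr 1
    field_simp
    ring
  set ρ := (2 : ℝ) ^ ((r - 1) / 2)
  have hρ' : 0 < ρ - 1 := by linarith
  rw [div_le_iff₀ (Real.sqrt_pos.2 hn'), mul_assoc, ← h3, geom_sum_eq hρ.ne', div_mul_eq_mul_div]
  gcongr
  rw [pow_succ]
  nlinarith

theorem rpow_neg_le_rpow_neg_half {r : ℝ} (hr : 0 < r) (hr' : r ≤ 1) {n : ℕ} (hn : 0 < n) :
    (n : ℝ) ^ (-(1 / (r + 1))) ≤ (n : ℝ) ^ (-(1 / 2) : ℝ) := by
  refine Real.rpow_le_rpow_of_exponent_le (by exact_mod_cast hn) (neg_le_neg ?_)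
  exact one_div_le_one_div_of_le (by linarith) (by linarith)

/-- The resolution at which the chaining is stopped and the resulting rate. In the degenerate
case `r = 1`, `n = 1` the rate `rateTau r n` vanishes. -/
theorem exists_resolution {r : ℝ} (hr : 0 < r) :
    ∃ A : ℝ, 0 < A ∧ ∀ n : ℕ, 0 < n → ∃ (K : ℕ) (x : ℝ),
      ((2 : ℝ) ^ ((r + 1) / 2)) ^ K ≤ √(n : ℝ) ∧
      (∑ k ∈ Finset.range (K + 1), ((2 : ℝ) ^ ((r - 1) / 2)) ^ k) / √(n : ℝ) ≤ A * x ∧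
      (1 / 2 : ℝ) ^ K ≤ A * x ∧
      (x = rateTau r n ∨ 1 ≤ r ∧ rateTau r n = 0 ∧ x = 1) := by
  have hβ : 1 < (2 : ℝ) ^ ((r + 1) / 2) := Real.one_lt_rpow (by norm_num) (by linarith)
  have hK : ∀ n : ℕ, 0 < n → ∃ K : ℕ, ((2 : ℝ) ^ ((r + 1) / 2)) ^ K ≤ √(n : ℝ) ∧
      √(n : ℝ) < ((2 : ℝ) ^ ((r + 1) / 2)) ^ (K + 1) := fun n hn =>
    exists_nat_pow_near (Real.one_le_sqrt.2 (by exact_mod_cast hn)) hβ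
  have hinv : ∀ n : ℕ, (√(n : ℝ))⁻¹ = (n : ℝ) ^ (-(1 / 2) : ℝ) := fun n => by
    rw [Real.sqrt_eq_rpow, Real.rpow_neg (Nat.cast_nonneg n)]
  rcases lt_trichotomy r 1 with h | h | h
  · have hρ : (2 : ℝ) ^ ((r - 1) / 2) < 1 :=
      Real.rpow_lt_one_of_one_lt_of_neg (by norm_num) (by linarith)
    set ρ := (2 : ℝ) ^ ((r - 1) / 2)
    have hρ0 : 0 < ρ := by positivity
    have hρ' : 0 < (1 - ρ)⁻¹ := inv_pos.2 (by linarith)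
    refine ⟨2 + (1 - ρ)⁻¹, by positivity, fun n hn => ?_⟩
    obtain ⟨K, hK1, hK2⟩ := hK n hn
    have hx : 0 ≤ (n : ℝ) ^ (-(1 / 2) : ℝ) := by positivity
    refine ⟨K, rateTau r n, hK1, ?_, ?_, Or.inl rfl⟩
    · rw [rateTau, if_pos h, div_eq_mul_inv, hinv]
      refine mul_le_mul_of_nonneg_right ?_ hx
      have := (summable_geometric_of_lt_one hρ0.le hρ).sum_le_tsum (Finset.range (K + 1))
        fun k _ => (pow_pos hρ0 k).le
      rw [tsum_geometric_of_lt_one hρ0.le hρ] at this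
      linarith
    · rw [rateTau, if_pos h]
      have h1 := half_pow_le_of_sqrt_lt hr hn hK2
      have h2 := rpow_neg_le_rpow_neg_half hr h.le hn
      nlinarith [mul_nonneg hρ'.le hx]
  · subst h
    have hl : 0 < Real.log 2 := Real.log_pos (by norm_num)
    have hl1 : Real.log 2 < 1 := by linarith [Real.log_two_lt_d9]
    -- Here `ρ = 1`, so the sum is `K + 1`, and `2ᴷ ≤ √n` makes this logarithmic in `n`.
    have e1 : (2 : ℝ) ^ (((1 : ℝ) + 1) / 2) = 2 := by norm_num
    have e2 : (2 : ℝ) ^ (((1 : ℝ) - 1) / 2) = 1 := by norm_num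
    refine ⟨2 / Real.log 2, by positivity, fun n hn => ?_⟩
    obtain ⟨K, hK1, hK2⟩ := hK n hn
    rcases Nat.lt_or_ge 1 n with hn1 | hn1
    · have hn2 : Real.log 2 ≤ Real.log n :=
        Real.log_le_log (by norm_num) (by exact_mod_cast hn1)
      have hq : 0 < √(n : ℝ) := Real.sqrt_pos.2 (by exact_mod_cast hn)
      have hτ : rateTau 1 n = Real.log n / √(n : ℝ) := by simp [rateTau]
      refine ⟨K, rateTau 1 n, hK1, ?_, ?_, Or.inl rfl⟩
      · rw [e1] at hK1
        have h1 := Real.log_le_log (by positivity) hK1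
        rw [Real.log_pow, Real.log_sqrt (Nat.cast_nonneg n)] at h1
        rw [hτ, ← mul_div_assoc]
        refine div_le_div_of_nonneg_right ?_ hq.le
        rw [e2, div_mul_eq_mul_div, le_div_iff₀ hl]
        simp only [one_pow, Finset.sum_const, Finset.card_range, nsmul_eq_mul, Nat.cast_add,
          Nat.cast_one, mul_one]
        linarith
      · have h1 := half_pow_le_of_sqrt_lt hr hn hK2
        have h2 := rpow_neg_le_rpow_neg_half hr le_rfl hn
        rw [← hinv] at h2
        refine (h1.trans (mul_le_mul_of_nonneg_left h2 (by norm_num))).trans ?_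
        rw [hτ, div_eq_mul_inv _ (√(n : ℝ)), ← mul_assoc]
        refine mul_le_mul_of_nonneg_right ?_ (inv_pos.2 hq).le
        rw [div_mul_eq_mul_div, le_div_iff₀ hl]
        linarith
    · obtain rfl : n = 1 := by omega
      refine ⟨0, 1, by simp, ?_, ?_, Or.inr ⟨le_rfl, by simp [rateTau], rfl⟩⟩
      · simp only [zero_add, Finset.range_one, Finset.sum_singleton, pow_zero, Nat.cast_one,
          Real.sqrt_one, mul_one, div_one]
        rw [le_div_iff₀ hl]
        linarith
      · rw [pow_zero, mul_one, le_div_iff₀ hl]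
        linarith
  · have hρ : 1 < (2 : ℝ) ^ ((r - 1) / 2) := Real.one_lt_rpow (by norm_num) (by linarith)
    set a := (2 : ℝ) ^ ((r - 1) / 2) / ((2 : ℝ) ^ ((r - 1) / 2) - 1)
    have ha0 : 0 < a := div_pos (by linarith) (by linarith)
    refine ⟨2 + a, by positivity, fun n hn => ?_⟩
    obtain ⟨K, hK1, hK2⟩ := hK n hn
    have hτ : rateTau r n = (n : ℝ) ^ (-(1 / (r + 1))) := by
      rw [rateTau, if_neg h.not_gt, if_neg h.ne']
    have hx : 0 ≤ (n : ℝ) ^ (-(1 / (r + 1))) := by positivity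
    refine ⟨K, rateTau r n, hK1, ?_, ?_, Or.inl rfl⟩
    · rw [hτ]
      exact (geom_sum_le_of_pow_le_sqrt h hn hK1).trans
        (mul_le_mul_of_nonneg_right (by linarith) hx)
    · rw [hτ]
      exact (half_pow_le_of_sqrt_lt hr hn hK2).trans
        (mul_le_mul_of_nonneg_right (by linarith) hx)

theorem rateTau_nonneg (r : ℝ) (n : ℕ) : 0 ≤ rateTau r n := by
  unfold rateTau
  split_ifs
  · positivity
  · exact div_nonneg (Real.log_natCast_nonneg n) (Real.sqrt_nonneg _)
  · positivity

/-- Normally the `τ` term alone suffices. When the rate vanishes, so does `q`, and the exponential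
term becomes the constant `4M`, which absorbs `x = 1`. -/
theorem half_mul_le_estimationBound {M r x : ℝ} (hM : 0 < M) {n : ℕ}
    (hx : x = rateTau r n ∨ 1 ≤ r ∧ rateTau r n = 0 ∧ x = 1) :
    1 / 2 * (M * x) ≤ estimationBound M M M M r n := by
  have hτ := mul_nonneg hM.le (rateTau_nonneg r n)
  unfold estimationBound
  rcases hx with rfl | ⟨h1, h2, rfl⟩
  · split_ifs
    · have := mul_pos hM (Real.exp_pos (-M ^ 2 * rateQ r n ^ 2))
      linarith
    · have : 0 ≤ (n : ℝ)⁻¹ * M := by positivity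
      linarith
  · rw [if_pos h1, rateQ, h2]
    norm_num
    linarith

end Rates

/-! ### Excess hinge risk of the empirical minimizer. -/

section EmpiricalRiskMinimization

variable {𝒳 : Type u} [MeasurableSpace 𝒳]

/-- The expected excess hinge risk of an empirical risk minimizer is at most the mean of any
uniform bound on the deviations. -/
theorem integral_hingeRisk_le_sInf_add {P : Measure (Label × 𝒳)} [IsProbabilityMeasure P]
    {F : Set (𝒳 → ℝ)} (hF : ∀ f ∈ F, Measurable f ∧ ∀ x, f x ∈ Set.Icc (-1 : ℝ) 1) {n : ℕ}
    (hn : 0 < n) {fhat : (Fin n → Label × 𝒳) → 𝒳 → ℝ}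
    (hfhat : ∀ s, fhat s ∈ F ∧ ∀ f ∈ F, empiricalHingeRisk s (fhat s) ≤ empiricalHingeRisk s f)
    {B : (Fin n → Label × 𝒳) → ℝ} (hB : Integrable B (Measure.pi fun _ => P))
    (hle : ∀ g ∈ hingeClass F, ∀ s, deviation P s g ≤ B s)
    (hi : Integrable (fun s => hingeRisk P (fhat s)) (Measure.pi fun _ : Fin n => P)) :
    ∫ s, hingeRisk P (fhat s) ∂(Measure.pi fun _ => P)
      ≤ sInf (hingeRisk P '' F) + ∫ s, B s ∂(Measure.pi fun _ => P) := by
  have hn' : (n : ℝ) ≠ 0 := by exact_mod_cast hn.ne'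
  have hne : (hingeRisk P '' F).Nonempty := by
    have : Nonempty (Label × 𝒳) := nonempty_of_isProbabilityMeasure P
    exact ⟨_, _, (hfhat fun _ => Classical.arbitrary _).1, rfl⟩
  rw [← sub_le_iff_le_add]
  refine le_csInf hne ?_
  rintro _ ⟨f, hf, rfl⟩
  have hgm := measurable_hingeLoss_label_mul (hF f hf).1
  have hg : Integrable (fun z : Label × 𝒳 => hingeLoss ((z.1 : ℝ) * f z.2)) P :=
    integrable_of_abs_le hgm (c := 2) fun z => by
      have := hingeLoss_label_mul_mem z.1 ((hF f hf).2 z.2)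
      rw [abs_of_nonneg this.1]
      exact this.2
  have hgi : ∀ i ∈ Finset.univ, Integrable (fun s : Fin n → Label × 𝒳 =>
      hingeLoss (((s i).1 : ℝ) * f (s i).2)) (Measure.pi fun _ => P) := fun i _ =>
    integrable_comp_eval (μ := fun _ : Fin n => P) (i := i) hg
  have hemp : Integrable (fun s : Fin n → Label × 𝒳 => empiricalHingeRisk s f)
      (Measure.pi fun _ => P) := (integrable_finsetSum _ hgi).const_mul _
  have hempI : ∫ s, empiricalHingeRisk s f ∂(Measure.pi fun _ : Fin n => P) = hingeRisk P f := by
    simp only [empiricalHingeRisk]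
    rw [integral_const_mul, integral_finsetSum _ hgi]
    have : ∀ i : Fin n, ∫ s, hingeLoss (((s i).1 : ℝ) * f (s i).2) ∂(Measure.pi fun _ => P)
        = hingeRisk P f := fun i =>
      integral_comp_eval (μ := fun _ : Fin n => P) (i := i)
        (f := fun z : Label × 𝒳 => hingeLoss ((z.1 : ℝ) * f z.2)) hgm.aestronglyMeasurable
    simp only [this, Finset.sum_const, Finset.card_univ, Fintype.card_fin, nsmul_eq_mul]
    field_simp
  -- Writing the competitor's risk as the mean of its empirical risk makes the claim pointwise in
  -- the sample: `R_h(f̂) ≤ R̂_h(f̂) + B ≤ R̂_h(f) + B`.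
  rw [sub_le_iff_le_add, ← hempI, ← integral_add hemp hB]
  refine integral_mono hi (hemp.add hB) fun s => ?_
  have h1 : hingeRisk P (fhat s) - empiricalHingeRisk s (fhat s) ≤ B s :=
    hle _ ⟨fhat s, (hfhat s).1, rfl⟩ s
  have h2 := (hfhat s).2 f hf
  change hingeRisk P (fhat s) ≤ empiricalHingeRisk s f + B s
  linarith

end EmpiricalRiskMinimization

/-! ### Assembly of the risk bound. -/

theorem theorem5 (C r : ℝ) (hC : 0 < C) (hr : 0 < r) :
    ∃ D₁ D₂ D₃ D₄ : ℝ, 0 < D₁ ∧ 0 < D₂ ∧ 0 < D₃ ∧ 0 < D₄ ∧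
      ∀ (𝒳 : Type u) [MeasurableSpace 𝒳]
        -- the class of admissible prediction sets
        (𝒢 : Set (Set 𝒳)) (_ : 𝒢.Nonempty) (_ : ∀ G ∈ 𝒢, MeasurableSet G)
        -- the subclass of the constrained class with its two defining conditions
        (F' : Set (𝒳 → ℝ)) (_ : F' ⊆ constrainedClass 𝒢)
        (_ : UpperLevelSetsIn F' 𝒢 ∨ LowerLevelSetsIn F' 𝒢)
        (_ : ∀ G ∈ 𝒢, stepClassifier G ∈ F')
        -- the approximating class
        (F : Set (𝒳 → ℝ)) (_ : ∀ f ∈ F, Measurable f ∧ ∀ x, f x ∈ Set.Icc (-1 : ℝ) 1)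
        -- the class of distributions, with the entropy condition
        (Ps : Set (ProbabilityMeasure (Label × 𝒳)))
        (_ : ∀ P ∈ Ps, ∀ ε : ℝ, 0 < ε →
          bracketingEntropy 1 ε F (P : Measure (Label × 𝒳)).snd
            ≤ ((C * ε ^ (-r) : ℝ) : EReal))
        -- the empirical hinge risk minimizer for samples of size `n`
        (n : ℕ) (_ : 0 < n) (fhat : (Fin n → Label × 𝒳) → 𝒳 → ℝ)
        (_ : ∀ s, fhat s ∈ F ∧
          ∀ f ∈ F, empiricalHingeRisk s (fhat s) ≤ empiricalHingeRisk s f)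
        (_ : ∀ P ∈ Ps,
          AEMeasurable (fun s => classificationRisk (P : Measure (Label × 𝒳)) (fhat s))
            (Measure.pi fun _ : Fin n => (P : Measure (Label × 𝒳))) ∧
          AEMeasurable (fun s => hingeRisk (P : Measure (Label × 𝒳)) (fhat s))
            (Measure.pi fun _ : Fin n => (P : Measure (Label × 𝒳)))),
        ∀ P ∈ Ps,
          ∫ s, (classificationRisk (P : Measure (Label × 𝒳)) (fhat s)
              - sInf (classificationRisk (P : Measure (Label × 𝒳)) '' constrainedClass 𝒢))
            ∂(Measure.pi fun _ : Fin n => (P : Measure (Label × 𝒳)))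
          ≤ estimationBound D₁ D₂ D₃ D₄ r n
            + 1 / 2 * (sInf (hingeRisk (P : Measure (Label × 𝒳)) '' F)
                - sInf (hingeRisk (P : Measure (Label × 𝒳)) '' F'))
            + 1 / 2 * ∫ s, (hingeRisk (P : Measure (Label × 𝒳))
                  (stepClassifier (predictionSet (fhat s)))
                - hingeRisk (P : Measure (Label × 𝒳)) (fhat s))
              ∂(Measure.pi fun _ : Fin n => (P : Measure (Label × 𝒳))) := by
  obtain ⟨A, hA, hres⟩ := exists_resolution hr
  -- The chaining sum contributes `(8C + 2)A` and the residual `2⁻ᴷ` one more `A`; this single value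
  -- serves as all four constants.
  have hM : 0 < (8 * C + 3) * A := by positivity
  refine ⟨_, _, _, _, hM, hM, hM, hM, ?_⟩
  intro 𝒳 _ 𝒢 h𝒢 h𝒢m F' hF' _ hstep F hF Ps hent n hn fhat hfhat hmeas Q hQ
  set P : Measure (Label × 𝒳) := (Q : Measure (Label × 𝒳))
  obtain ⟨K, x, hK, hsum, hhalf, hx⟩ := hres n hn
  have hρ : 0 < (2 : ℝ) ^ ((r - 1) / 2) := by positivity
  have hβ : 1 < (2 : ℝ) ^ ((r + 1) / 2) := Real.one_lt_rpow (by norm_num) (by linarith)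
  have hρβ : (2 : ℝ) ^ ((r + 1) / 2) = 2 * (2 : ℝ) ^ ((r - 1) / 2) := by
    rw [← Real.rpow_one_add' (by norm_num) (by linarith)]
    congr 1
    ring
  -- At `ε = 2⁻ᵏ` the entropy bound is `C (2ʳ)ᵏ`, so `ρβ` must be `2ʳ`; together with `β = 2ρ` this
  -- determines `ρ` and `β`.
  have hprod : (2 : ℝ) ^ ((r - 1) / 2) * (2 : ℝ) ^ ((r + 1) / 2) = 2 ^ r := by
    rw [← Real.rpow_add (by norm_num)]
    congr 1
    ring
  have hcover : ∀ k : ℕ, ∃ (N : ℕ) (l : Fin N → Label × 𝒳 → ℝ),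
      IsLowerCover P (hingeClass F) ((1 / 2) ^ k) l ∧ (N : ℝ) ≤ Real.exp (C *
        ((2 : ℝ) ^ ((r - 1) / 2) * (2 : ℝ) ^ ((r + 1) / 2)) ^ k) := fun k => by
    have hε : (0 : ℝ) < (1 / 2) ^ k := by positivity
    obtain ⟨N, hN, hNle⟩ := exists_isBracketCover_of_bracketingEntropy_le (hent Q hQ _ hε)
    obtain ⟨l, hl⟩ := exists_isLowerCover_hingeClass hF hε hN
    refine ⟨N, l, hl, hNle.trans (le_of_eq ?_)⟩
    rw [hprod, one_div, inv_pow, Real.inv_rpow (by positivity), Real.rpow_neg (by positivity),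
      inv_inv, ← Real.rpow_natCast, ← Real.rpow_natCast, ← Real.rpow_mul (by norm_num),
      ← Real.rpow_mul (by norm_num), mul_comm r]
  choose N l hl hN using hcover
  obtain ⟨B, hB, hle, hI⟩ := exists_uniform_deviation_le (μ := P) (𝓒 := hingeClass F)
    (by
      rintro _ ⟨f, hf, rfl⟩
      exact ⟨measurable_hingeLoss_label_mul (hF f hf).1, fun z =>
        hingeLoss_label_mul_mem z.1 ((hF f hf).2 z.2)⟩) hC hρ hβ hρβ
    (by rw [hprod]; exact Real.one_le_rpow (by norm_num) hr.le) hl hN hn K hK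
  have hBI : ∫ s, B s ∂(Measure.pi fun _ => P) ≤ (8 * C + 3) * A * x := by
    rw [mul_div_assoc] at hI
    have := mul_le_mul_of_nonneg_left hsum (show 0 ≤ 8 * C + 2 by positivity)
    linarith
  obtain ⟨hm1, hm2⟩ := hmeas Q hQ
  have hi1 : Integrable (fun s => classificationRisk P (fhat s))
      (Measure.pi fun _ : Fin n => P) :=
    Integrable.of_bound hm1.aestronglyMeasurable 1 (ae_of_all _ fun s => by
      rw [classificationRisk, Real.norm_of_nonneg measureReal_nonneg]
      exact measureReal_le_one)
  have hi2 : Integrable (fun s => hingeRisk P (fhat s)) (Measure.pi fun _ : Fin n => P) :=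
    Integrable.of_bound hm2.aestronglyMeasurable 2 (ae_of_all _ fun s =>
      (norm_integral_le_of_norm_le_const (ae_of_all _ fun z : Label × 𝒳 => by
        have := hingeLoss_label_mul_mem z.1 ((hF _ (hfhat s).1).2 z.2)
        rw [Real.norm_of_nonneg this.1]
        exact this.2)).trans (by simp))
  have hexc := integral_hingeRisk_le_sInf_add hF hn hfhat hB hle hi2
  have hinf := sInf_hingeRisk_le_two_mul_sInf_classificationRisk (P := P) h𝒢 h𝒢m hstep hF'
  have hbound := half_mul_le_estimationBound hM hx
  have hrisk : ∀ s, hingeRisk P (stepClassifier (predictionSet (fhat s)))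
      = 2 * classificationRisk P (fhat s) := fun s =>
    hingeRisk_stepClassifier (measurableSet_le measurable_const (hF _ (hfhat s).1).1)
  simp_rw [hrisk]
  rw [integral_sub hi1 (integrable_const _), integral_sub (hi1.const_mul 2) hi2,
    integral_const_mul]
  simp only [integral_const, probReal_univ, one_smul]
  linarith
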